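/- Let $c\in\mathbb{R}\setminus\{0\}$ and let $n>0$ be a real number such that $n>c$ if $c>0$, and $n=-cl$ for some $l\in\mathbb{N}$ if $c<0$. Let $I_c=[0,-\tfrac1c]$ if $c<0$ and $I_c=[0,+\infty)$ if $c>0$. For real $\alpha$ put $\binom{\alpha}{0}=1$ and $\binom{\alpha}{k}=\frac{\alpha(\alpha-1)\cdots(\alpha-k+1)}{k!}$ for $k\geq 1$. For $m>0$, an integer $k\ge 0$ and $x\in I_c$ let $$p_{m,k}^{[c]}(x)=(-1)^k\binom{-m/c}{k}(cx)^k(1+cx)^{-\frac mc-k},\qquad S_{m,c}(x)=\sum_{k=0}^\infty\left(p_{m,k}^{[c]}(x)\right)^2,$$ where, if $c<0$ and $x=-\tfrac1c$, we read $0^0=1$ and terms with $\binom{-m/c}{k}=0$ are $0$. Then for every $x\in I_c$ the series $S_{n,c}(x)$ and $S_{n-c,c}(x)$ converge, and $$S_{n-c,c}(x)\ \geq\ \bigl(1+2cx(1+cx)\bigr)\,S_{n,c}(x)\quad\text{if } c<0,$$ $$S_{n-c,c}(x)\ \leq\ \bigl(1+2cx(1+cx)\bigr)\,S_{n,c}(x)\quad\text{if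 } c>0.$$ -/

import Mathlib

namespace IndexOfCoincidence

/-- The generalized binomial coefficient `α (α - 1) ⋯ (α - k + 1) / k!`, equal to `1` for
`k = 0`. -/
noncomputable def binom (α : ℝ) (k : ℕ) : ℝ :=
  (∏ i ∈ Finset.range k, (α - (i : ℝ))) / (k.factorial : ℝ)

/-- The domain `I_c`: `[0, -1/c]` if `c < 0` and `[0, ∞)` if `c ≥ 0`. -/
noncomputable def domain (c : ℝ) : Set ℝ :=
  if c < 0 then Set.Icc 0 (-1 / c) else Set.Ici 0

/-- The weights `p_{n,k}^{[c]}(x)`, with the Poisson weights at `c = 0`.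
If `c < 0`, `n = -c l` and `x = -1/c`, then `1 + c x = 0` and the power has exponent `l - k`:
it is `0 ^ 0 = 1` for `k = l`, and for `k > l` the binomial coefficient vanishes. -/
noncomputable def p (n c : ℝ) (k : ℕ) (x : ℝ) : ℝ :=
  if c = 0 then (n * x) ^ k / (k.factorial : ℝ) * Real.exp (-(n * x))
  else (-1) ^ k * binom (-n / c) k * (c * x) ^ k * (1 + c * x) ^ (-n / c - (k : ℝ))

/-- The index of coincidence `S_{n,c}(x) = ∑_{k ≥ 0} (p_{n,k}^{[c]}(x))²`. -/
noncomputable def S (n c x : ℝ) : ℝ := ∑' k : ℕ, (p n c k x) ^ 2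

/-- The admissible parameters: `n > 0`, with `n > c` if `c ≥ 0`, and `n = -c l` for a natural
number `l` if `c < 0` (so that `l ≥ 1`). -/
def Admissible (n c : ℝ) : Prop :=
  0 < n ∧ (0 ≤ c → c < n) ∧ (c < 0 → ∃ l : ℕ, n = -c * (l : ℝ))

end IndexOfCoincidence

/-!
With `α = -n / c`, Pascal's rule for `binom (α + 1) k` reads
`p (n - c) c (k + 1) = (1 + c x) p n c (k + 1) - c x p n c k`, so squaring and summing gives
`S (n - c) = ((1 + c x)² + (c x)²) S n - 2 c x (1 + c x) ∑ₖ p n c k p n c (k + 1)`.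
The ratio `(1 + c x) p n c (k + 1) = x (n + c k) / (k + 1) p n c k` of consecutive weights turns
the last term into `2 ∑ₖ c (n + c k) / (k + 1) (x p n c k)²`, whose sign is that of `c (n + c k)`:
this is nonnegative for `n, c ≥ 0`, and equals `c² (k - l) ≤ 0` for `n = -c l` as long as `k ≤ l`,
while the weights with `k > l` vanish.
-/

namespace IndexOfCoincidence

open Filter Topology

lemma summable_mul_of_summable_sq {ι : Type*} {f g : ι → ℝ} (hf : Summable fun i ↦ f i ^ 2)
    (hg : Summable fun i ↦ g i ^ 2) : Summable fun i ↦ f i * g i := by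
  refine .of_norm_bounded (hf.add hg) fun i ↦ ?_
  rw [Real.norm_eq_abs, abs_mul, ← sq_abs (f i), ← sq_abs (g i)]
  nlinarith [two_mul_le_add_sq |f i| |g i|, abs_nonneg (f i), abs_nonneg (g i)]

lemma hasSum_sq_of_recurrence {a b : ℕ → ℝ} {A B : ℝ} (ha : Summable fun k ↦ a k ^ 2)
    (h0 : b 0 = A * a 0) (hsucc : ∀ k, b (k + 1) = A * a (k + 1) - B * a k) :
    HasSum (fun k ↦ b k ^ 2)
      ((A ^ 2 + B ^ 2) * ∑' k, a k ^ 2 - 2 * ∑' k, A * B * (a k * a (k + 1))) := by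
  have ha' : Summable fun k ↦ a (k + 1) ^ 2 := (summable_nat_add_iff 1).2 ha
  have hcross : Summable fun k ↦ A * B * (a k * a (k + 1)) :=
    (summable_mul_of_summable_sq ha ha').mul_left _
  rw [← hasSum_nat_add_iff' 1]
  convert ((ha'.hasSum.mul_left (A ^ 2)).add (ha.hasSum.mul_left (B ^ 2))).sub
    (hcross.hasSum.mul_left 2) using 1
  · ext k
    rw [hsucc]
    ring
  · rw [ha.tsum_eq_zero_add, Finset.sum_range_one, h0]
    ring

lemma binom_eq_choose (α : ℝ) (k : ℕ) : binom α k = Ring.choose α k := by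
  rw [Ring.choose_eq_smul, ← Polynomial.aeval_eq_smeval, Polynomial.aeval_def,
    Polynomial.eval₂_eq_eval_map, descPochhammer_map, descPochhammer_eval_eq_prod_range,
    smul_eq_mul, inv_mul_eq_div, binom]

lemma binom_succ (α : ℝ) (k : ℕ) : binom α (k + 1) = (α - k) / (k + 1) * binom α k := by
  rw [binom, binom, Finset.prod_range_succ, Nat.factorial_succ]
  push_cast
  field_simp

lemma binom_add_one_succ (α : ℝ) (k : ℕ) :
    binom (α + 1) (k + 1) = binom α k + binom α (k + 1) := by
  simp only [binom_eq_choose, Ring.choose_succ_succ]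

lemma binom_natCast_eq_zero {l k : ℕ} (hlk : l < k) : binom l k = 0 := by
  rw [binom_eq_choose, Ring.choose_natCast, Nat.choose_eq_zero_of_lt hlk, Nat.cast_zero]

lemma mul_rpow_sub_one {t β : ℝ} (h : t = 0 → β ≠ 0) : t * t ^ (β - 1) = t ^ β := by
  rcases eq_or_ne t 0 with rfl | ht
  · rw [zero_mul, Real.zero_rpow (h rfl)]
  · rw [Real.rpow_sub_one ht, mul_div_cancel₀ _ ht]

-- At `t = 0`, `α = k` the powers are `0 ^ (-1) = 0` and `0 ^ 0 = 1`; there `binom α (k + 1) = 0`.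
lemma binom_succ_mul_mul_rpow (α t : ℝ) (k : ℕ) :
    binom α (k + 1) * (t * t ^ (α - (k + 1 : ℕ))) = binom α (k + 1) * t ^ (α - k) := by
  rcases eq_or_ne (α - k) 0 with h | h
  · rw [binom_succ, h, zero_div, zero_mul, zero_mul, zero_mul]
  · rw [Nat.cast_succ, ← sub_sub, mul_rpow_sub_one fun _ ↦ h]

lemma neg_sub_div_self {K : Type*} [Field K] {n c : K} (hc : c ≠ 0) :
    -(n - c) / c = -n / c + 1 := by
  field_simp
  ring

lemma p_zero {n c x : ℝ} (hc : c ≠ 0) : p n c 0 x = (1 + c * x) ^ (-n / c) := by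
  simp [p, hc, binom]

lemma one_add_mul_mul_p_succ (n c x : ℝ) (k : ℕ) :
    (1 + c * x) * p n c (k + 1) x = x * ((n + c * k) / (k + 1)) * p n c k x := by
  rcases eq_or_ne c 0 with rfl | hc
  · simp only [p, if_pos, Nat.factorial_succ]
    push_cast
    field_simp
    ring
  · have hcoeff : c * x * (-n / c - k) = -(x * (n + c * k)) := by
      field_simp
      ring
    have hpow := binom_succ_mul_mul_rpow (-n / c) (1 + c * x) k
    rw [binom_succ (-n / c) k] at hpow
    simp only [p, if_neg hc, binom_succ (-n / c) k]
    linear_combination (-1) ^ (k + 1) * (c * x) ^ (k + 1) * hpow -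
        (-1) ^ k * (c * x) ^ k * binom (-n / c) k * (1 + c * x) ^ (-n / c - k) / (k + 1) * hcoeff

lemma p_sub_zero {n c x : ℝ} (h : 1 + c * x = 0 → n ≠ c) :
    p (n - c) c 0 x = (1 + c * x) * p n c 0 x := by
  rcases eq_or_ne c 0 with rfl | hc
  · simp
  · have hexp : 1 + c * x = 0 → -n / c + 1 ≠ 0 := fun hx ↦ by
      rw [← neg_sub_div_self hc]
      exact div_ne_zero (neg_ne_zero.2 (sub_ne_zero.2 (h hx))) hc
    rw [p_zero hc, p_zero hc, neg_sub_div_self hc, ← mul_rpow_sub_one hexp, add_sub_cancel_right]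

lemma p_sub_succ (n c x : ℝ) (k : ℕ) :
    p (n - c) c (k + 1) x = (1 + c * x) * p n c (k + 1) x - c * x * p n c k x := by
  rcases eq_or_ne c 0 with rfl | hc
  · simp
  · have hexp : -n / c + 1 - (k + 1 : ℕ) = -n / c - k := by
      push_cast
      ring
    simp only [p, if_neg hc, neg_sub_div_self hc, binom_add_one_succ, hexp]
    linear_combination
      -(-1) ^ (k + 1) * (c * x) ^ (k + 1) * binom_succ_mul_mul_rpow (-n / c) (1 + c * x) k

lemma p_neg_mul_natCast_eq_zero (c x : ℝ) {l k : ℕ} (hlk : l < k) : p (-c * l) c k x = 0 := by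
  rcases eq_or_ne c 0 with rfl | hc
  · simp [p, Nat.ne_zero_of_lt hlk]
  · simp [p, hc, binom_natCast_eq_zero hlk]

lemma summable_p_sq_neg_mul_natCast (c x : ℝ) (l : ℕ) :
    Summable fun k ↦ p (-c * l) c k x ^ 2 := by
  refine summable_of_ne_finset_zero (s := Finset.range (l + 1)) fun k hk ↦ ?_
  have hlk : l < k := by simpa [Nat.lt_succ_iff] using hk
  rw [p_neg_mul_natCast_eq_zero c x hlk, zero_pow two_ne_zero]

lemma summable_p_sq (n : ℝ) {c x : ℝ} (hx : 0 < 1 + 2 * c * x) :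
    Summable fun k ↦ p n c k x ^ 2 := by
  have hpos : 0 < 1 + c * x := by linarith
  have hlt : (x * c / (1 + c * x)) ^ 2 < 1 := by
    rw [div_pow, div_lt_one (by positivity)]
    linarith
  have hratio : Tendsto (fun k : ℕ ↦ (x * ((n + c * k) / (k + 1)) / (1 + c * x)) ^ 2) atTop
      (𝓝 ((x * c / (1 + c * x)) ^ 2)) := by
    have hlim : Tendsto (fun k : ℕ ↦ (n + c * k) / (k + 1 : ℝ)) atTop (𝓝 c) := by
      simpa [add_comm (1 : ℝ)] using tendsto_add_mul_div_add_mul_atTop_nhds n 1 c one_ne_zero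
    exact ((hlim.const_mul x).div_const _).pow 2
  obtain ⟨r, hr, hr1⟩ := exists_between hlt
  refine summable_of_ratio_norm_eventually_le hr1 ?_
  filter_upwards [hratio.eventually_le_const hr] with k hk
  have hsucc : p n c (k + 1) x = x * ((n + c * k) / (k + 1)) / (1 + c * x) * p n c k x := by
    rw [div_mul_eq_mul_div, ← one_add_mul_mul_p_succ, mul_div_cancel_left₀ _ hpos.ne']
  rw [hsucc, mul_pow, norm_mul, Real.norm_of_nonneg (sq_nonneg (_ / _))]
  gcongr

lemma hasSum_p_sub_sq {n c x : ℝ} (hs : Summable fun k ↦ p n c k x ^ 2)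
    (h : 1 + c * x = 0 → n ≠ c) :
    HasSum (fun k ↦ p (n - c) c k x ^ 2)
      ((1 + 2 * c * x * (1 + c * x)) * S n c x -
        2 * ∑' k : ℕ, c * (n + c * k) / (k + 1) * (x * p n c k x) ^ 2) := by
  have hcross (k : ℕ) : c * (n + c * k) / (k + 1) * (x * p n c k x) ^ 2 =
      (1 + c * x) * (c * x) * (p n c k x * p n c (k + 1) x) := by
    linear_combination -(c * x * p n c k x) * one_add_mul_mul_p_succ n c x k
  simp only [hcross, S]
  convert hasSum_sq_of_recurrence (b := fun k ↦ p (n - c) c k x) hs (p_sub_zero h)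
    (p_sub_succ n c x) using 3
  ring

theorem le_S_sub_of_eq_neg_mul_natCast {n c x : ℝ} {l : ℕ} (hn : n = -c * l) :
    Summable (fun k ↦ p n c k x ^ 2) ∧ Summable (fun k ↦ p (n - c) c k x ^ 2) ∧
      (1 + 2 * c * x * (1 + c * x)) * S n c x ≤ S (n - c) c x := by
  subst hn
  have hs := summable_p_sq_neg_mul_natCast c x l
  have hsub := hasSum_p_sub_sq hs fun hx hlc ↦ by
    have hc : c * (l + 1 : ℝ) = 0 := by linarith
    have hc0 : c = 0 := (mul_eq_zero.1 hc).resolve_right (by positivity)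
    simp [hc0] at hx
  refine ⟨hs, hsub.summable, ?_⟩
  have hcorr : ∑' k : ℕ, c * (-c * l + c * k) / (k + 1) * (x * p (-c * l) c k x) ^ 2 ≤ 0 := by
    refine tsum_nonpos fun k ↦ ?_
    rcases lt_or_ge l k with hlk | hkl
    · rw [p_neg_mul_natCast_eq_zero c x hlk, mul_zero, zero_pow two_ne_zero, mul_zero]
    · have hsign : c * (-c * l + c * k) ≤ 0 :=
        calc c * (-c * l + c * k) = c ^ 2 * (k - l) := by ring
          _ ≤ 0 := mul_nonpos_of_nonneg_of_nonpos (sq_nonneg c) (sub_nonpos.2 (Nat.cast_le.2 hkl))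
      exact mul_nonpos_of_nonpos_of_nonneg (div_nonpos_of_nonpos_of_nonneg hsign (by positivity))
        (sq_nonneg _)
  have hS : S (-c * l - c) c x = _ := hsub.tsum_eq
  linarith

theorem S_sub_le_of_nonneg {n c x : ℝ} (hn : 0 ≤ n) (hc : 0 ≤ c) (hx : 0 < 1 + 2 * c * x) :
    Summable (fun k ↦ p n c k x ^ 2) ∧ Summable (fun k ↦ p (n - c) c k x ^ 2) ∧
      S (n - c) c x ≤ (1 + 2 * c * x * (1 + c * x)) * S n c x := by
  have hs := summable_p_sq n hx
  have hsub := hasSum_p_sub_sq hs fun hx0 ↦ by linarith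
  refine ⟨hs, hsub.summable, ?_⟩
  have hcorr : 0 ≤ ∑' k : ℕ, c * (n + c * k) / (k + 1) * (x * p n c k x) ^ 2 :=
    tsum_nonneg fun k ↦ by positivity
  have hS : S (n - c) c x = _ := hsub.tsum_eq
  linarith

end IndexOfCoincidence

-- No junk real power is involved outside `domain c`: for `n = -c l` the nonzero weights have
-- exponents `l - k ∈ ℕ`, and `0 < 1 + 2 c x` makes the base `1 + c x` positive.
open IndexOfCoincidence in
theorem theorem4p1_general (n c x : ℝ) :
    ((∃ l : ℕ, n = -c * l) →
      Summable (fun k ↦ p n c k x ^ 2) ∧ Summable (fun k ↦ p (n - c) c k x ^ 2) ∧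
        (1 + 2 * c * x * (1 + c * x)) * S n c x ≤ S (n - c) c x) ∧
    (0 ≤ n → 0 ≤ c → 0 < 1 + 2 * c * x →
      Summable (fun k ↦ p n c k x ^ 2) ∧ Summable (fun k ↦ p (n - c) c k x ^ 2) ∧
        S (n - c) c x ≤ (1 + 2 * c * x * (1 + c * x)) * S n c x) :=
  ⟨fun ⟨_, hn⟩ ↦ le_S_sub_of_eq_neg_mul_natCast hn, S_sub_le_of_nonneg⟩

theorem theorem4p1 (n c x : ℝ) (hnc : IndexOfCoincidence.Admissible n c)
    (hx : x ∈ IndexOfCoincidence.domain c) :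
    (c < 0 →
      Summable (fun k : ℕ => (IndexOfCoincidence.p n c k x) ^ 2) ∧
      Summable (fun k : ℕ => (IndexOfCoincidence.p (n - c) c k x) ^ 2) ∧
      IndexOfCoincidence.S (n - c) c x ≥
        (1 + 2 * c * x * (1 + c * x)) * IndexOfCoincidence.S n c x) ∧
    (0 < c →
      Summable (fun k : ℕ => (IndexOfCoincidence.p n c k x) ^ 2) ∧
      Summable (fun k : ℕ => (IndexOfCoincidence.p (n - c) c k x) ^ 2) ∧
      IndexOfCoincidence.S (n - c) c x ≤
        (1 + 2 * c * x * (1 + c * x)) * IndexOfCoincidence.S n c x) := by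
  obtain ⟨hneg, hpos⟩ := theorem4p1_general n c x
  refine ⟨fun hc ↦ hneg (hnc.2.2 hc), fun hc ↦ hpos hnc.1.le hc.le ?_⟩
  have hx0 : 0 ≤ x := by simpa [IndexOfCoincidence.domain, hc.not_gt] using hx
  positivity
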